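/- Let $(M,g)$ be a connected smooth $4$-dimensional Lorentzian manifold of signature $(-,+,+,+)$, with Levi-Civita connection $\nabla$, Ricci tensor $S$ (with $S(Y,Z)$ the trace of $X\mapsto R(X,Y)Z$, where $R(X,Y)Z=\nabla_X\nabla_YZ-\nabla_Y\nabla_XZ-\nabla_{[X,Y]}Z$) and scalar curvature $r$. Let $\xi$ be a smooth vector field with $g(\xi,\xi)=-1$, and put $\eta(X)=g(X,\xi)$. Let $\sigma,\rho$ be smooth real functions on $M$ (energy density and isotropic pressure), and let $\lambda,\kappa$ be real constants (cosmological and gravitational constant). Assume that $(M,g)$ is a perfect fluid spacetime, i.e. $$S+\Bigl(\lambda-\frac r2\Bigr)g=\kappa T,\qquad T=\rho\,g+(\sigma+\rho)\,\eta\otimes\eta,$$ and that $\xi$ is torse-forming in the sense that $\nabla_X\xi=X+\eta(X)\xi$ for all $X$. Suppose that $(M,g)$ admits a Ricci soliton $(g,V,\Lambda)$, i.e. a smooth vector field $V$ and a real constant $\Lambda$ with $$L_Vg+2S+2\Lambda g=0;$$ the soliton is called expanding, steady or shrinking according as $\Lambda>0$, $\Lambda=0$ or $\Lambda<0$. Then,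 everywhere on $M$, $$\bigl(2\lambda-\kappa(\sigma+3\rho)\bigr)\Bigl(\lambda-\frac{\kappa(\sigma+3\rho)}2+\Lambda\Bigr)=0 .$$ Moreover, one of the following two alternatives holds: (1) $\lambda=\frac{\kappa(\sigma+3\rho)}2$ everywhere on $M$, $S=\kappa(\sigma+\rho)\,(g+\eta\otimes\eta)$, and the soliton is not steady; or (2) $\Lambda=\frac{\kappa(\sigma+3\rho)}2-\lambda$ everywhere on $M$, and either the soliton is expanding and $\frac{\kappa(\sigma+3\rho)}2>\lambda$ everywhere, or the soliton is shrinking and $\frac{\kappa(\sigma+3\rho)}2<\lambda$ everywhere. -/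

import Mathlib

open scoped Manifold ContDiff

noncomputable section

namespace Spacetime

/-- The model space of the coordinates. -/
abbrev R4 : Type := EuclideanSpace ℝ (Fin 4)

section PointwiseObjects

variable (M : Type*) [TopologicalSpace M] [ChartedSpace R4 M] [IsManifold (𝓡 4) ∞ M]

/-- A smooth Lorentzian metric of signature `(-,+,+,+)` on the 4-manifold `M`: a smooth field of
symmetric bilinear forms on the tangent spaces, each of which has a basis in which it is
`diag(-1, 1, 1, 1)`. -/
structure LorentzMetric where
  val : ∀ p : M, TangentSpace (𝓡 4) p →L[ℝ] TangentSpace (𝓡 4) p →L[ℝ] ℝ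
  symm : ∀ (p : M) (u v : TangentSpace (𝓡 4) p), val p u v = val p v u
  signature : ∀ p : M, ∃ b : Module.Basis (Fin 4) ℝ (TangentSpace (𝓡 4) p),
    ∀ i j : Fin 4, val p (b i) (b j) = if i = j then (if i = 0 then -1 else 1) else 0
  contMDiff : ContMDiff (𝓡 4) ((𝓡 4).prod 𝓘(ℝ, R4 →L[ℝ] R4 →L[ℝ] ℝ)) ∞
    (fun p : M => Bundle.TotalSpace.mk' (R4 →L[ℝ] R4 →L[ℝ] ℝ)
      (E := fun p : M => TangentSpace (𝓡 4) p →L[ℝ] TangentSpace (𝓡 4) p →L[ℝ] ℝ) p (val p))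

/-- A smooth vector field on `M`. -/
structure SmoothVectorField where
  val : ∀ p : M, TangentSpace (𝓡 4) p
  contMDiff : ContMDiff (𝓡 4) (𝓡 4).tangent ∞
    (fun p : M => (⟨p, val p⟩ : TangentBundle (𝓡 4) M))

end PointwiseObjects

/-! ### Tensor calculus in coordinates

`G` is the matrix of components of a metric and `X` the components of a vector field, as functions
of the coordinates `y`. -/

section Coordinates

/-- The partial derivative of `f` with respect to the `i`-th coordinate. -/
def pderiv (i : Fin 4) (f : R4 → ℝ) (y : R4) : ℝ :=
  fderiv ℝ f y (EuclideanSpace.single i 1)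

/-- Christoffel symbols of the Levi-Civita connection,
`Γ^k_{ij} = 1/2 g^{kl} (∂_i g_{jl} + ∂_j g_{il} - ∂_l g_{ij})`, so that
`∇_{∂_i} ∂_j = Γ^k_{ij} ∂_k`. -/
def christoffel (G : R4 → Matrix (Fin 4) (Fin 4) ℝ) (k i j : Fin 4) (y : R4) : ℝ :=
  (1 / 2) * ∑ l, (G y)⁻¹ k l *
    (pderiv i (fun z => G z j l) y + pderiv j (fun z => G z i l) y - pderiv l (fun z => G z i j) y)

/-- Components `(∇_{∂_i} X)^k = ∂_i X^k + Γ^k_{ij} X^j` of the covariant derivative of `X`. -/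
def covDeriv (G : R4 → Matrix (Fin 4) (Fin 4) ℝ) (X : R4 → Fin 4 → ℝ) (i k : Fin 4) (y : R4) : ℝ :=
  pderiv i (fun z => X z k) y + ∑ j, christoffel G k i j y * X y j

/-- The `l`-th component of `R(∂_i, ∂_j) ∂_k`, where
`R(X, Y) Z = ∇_X ∇_Y Z - ∇_Y ∇_X Z - ∇_{[X, Y]} Z`. -/
def riemann (G : R4 → Matrix (Fin 4) (Fin 4) ℝ) (i j k l : Fin 4) (y : R4) : ℝ :=
  pderiv i (christoffel G l j k) y - pderiv j (christoffel G l i k) y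
    + ∑ m, (christoffel G l i m y * christoffel G m j k y
      - christoffel G l j m y * christoffel G m i k y)

/-- The Ricci tensor: `S(∂_j, ∂_k)` is the trace of `X ↦ R(X, ∂_j) ∂_k`. -/
def ricci (G : R4 → Matrix (Fin 4) (Fin 4) ℝ) (j k : Fin 4) (y : R4) : ℝ :=
  ∑ i, riemann G i j k i y

/-- The scalar curvature `g^{jk} S_{jk}`. -/
def scalarCurv (G : R4 → Matrix (Fin 4) (Fin 4) ℝ) (y : R4) : ℝ :=
  ∑ j, ∑ k, (G y)⁻¹ j k * ricci G j k y

/-- Components `X_i = g_{ij} X^j` of the 1-form metrically equivalent to `X`. -/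
def lower (G : R4 → Matrix (Fin 4) (Fin 4) ℝ) (X : R4 → Fin 4 → ℝ) (i : Fin 4) (y : R4) : ℝ :=
  ∑ j, G y i j * X y j

/-- The Lie derivative of the metric along `X`,
`(L_X g)_{ij} = X^k ∂_k g_{ij} + g_{kj} ∂_i X^k + g_{ik} ∂_j X^k`. -/
def lieDerivMetric (G : R4 → Matrix (Fin 4) (Fin 4) ℝ) (X : R4 → Fin 4 → ℝ) (i j : Fin 4)
    (y : R4) : ℝ :=
  ∑ k, (X y k * pderiv k (fun z => G z i j) y
    + G y k j * pderiv i (fun z => X z k) y + G y i k * pderiv j (fun z => X z k) y)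

end Coordinates

/-! ### Geometric notions on a spacetime

Tensor equations on `M` are expressed by their components in every chart of the atlas. -/

section Manifold

variable {M : Type*} [TopologicalSpace M] [ChartedSpace R4 M] [IsManifold (𝓡 4) ∞ M]

/-- The coordinate vector field `∂_i` of the chart `e`, at the point with coordinates `y`. -/
def coordVec (e : OpenPartialHomeomorph M R4) (y : R4) (i : Fin 4) :
    TangentSpace (𝓡 4) (e.symm y) :=
  mfderiv 𝓘(ℝ, R4) (𝓡 4) e.symm y (EuclideanSpace.single i (1 : ℝ) : R4)

/-- The components `g_{ij} = g(∂_i, ∂_j)` of the metric in the chart `e`. -/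
def LorentzMetric.inChart (g : LorentzMetric M) (e : OpenPartialHomeomorph M R4) (y : R4) :
    Matrix (Fin 4) (Fin 4) ℝ :=
  Matrix.of fun i j => g.val (e.symm y) (coordVec e y i) (coordVec e y j)

/-- The components `X^i = dx^i(X)` of a vector field in the chart `e`. -/
def SmoothVectorField.inChart (X : SmoothVectorField M) (e : OpenPartialHomeomorph M R4) (y : R4)
    (i : Fin 4) : ℝ :=
  let w : R4 := mfderiv (𝓡 4) 𝓘(ℝ, R4) e (e.symm y) (X.val (e.symm y))
  w i

/-- `ξ` is a unit timelike vector field: `g(ξ, ξ) = -1`. -/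
def IsUnitTimelike (g : LorentzMetric M) (ξ : SmoothVectorField M) : Prop :=
  ∀ p : M, g.val p (ξ.val p) (ξ.val p) = -1

/-- `ξ` is torse-forming: `∇_X ξ = X + η(X) ξ` for all `X`, where `η(X) = g(X, ξ)`. -/
def IsTorseForming (g : LorentzMetric M) (ξ : SmoothVectorField M) : Prop :=
  ∀ e ∈ atlas R4 M, ∀ y ∈ e.target, ∀ i k : Fin 4,
    covDeriv (g.inChart e) (ξ.inChart e) i k y =
      (if i = k then 1 else 0) + lower (g.inChart e) (ξ.inChart e) i y * ξ.inChart e y k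

/-- The components `T_{ij} = ρ g_{ij} + (σ + ρ) η_i η_j` of the energy-momentum tensor of a perfect
fluid with velocity `ξ`, energy density `σ` and isotropic pressure `ρ`. -/
def fluidTensor (g : LorentzMetric M) (ξ : SmoothVectorField M) (σ ρ : M → ℝ)
    (e : OpenPartialHomeomorph M R4) (i j : Fin 4) (y : R4) : ℝ :=
  ρ (e.symm y) * g.inChart e y i j + (σ (e.symm y) + ρ (e.symm y)) *
    (lower (g.inChart e) (ξ.inChart e) i y * lower (g.inChart e) (ξ.inChart e) j y)

/-- Einstein's field equation `S + (lam - r/2) g = κ T` for a perfect fluid, with cosmological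
constant `lam` and gravitational constant `κ`. -/
def PerfectFluidEquation (g : LorentzMetric M) (ξ : SmoothVectorField M) (σ ρ : M → ℝ)
    (lam κ : ℝ) : Prop :=
  ∀ e ∈ atlas R4 M, ∀ y ∈ e.target, ∀ i j : Fin 4,
    ricci (g.inChart e) i j y + (lam - scalarCurv (g.inChart e) y / 2) * g.inChart e y i j =
      κ * fluidTensor g ξ σ ρ e i j y

/-- `(g, V, Λ)` is a Ricci soliton: `L_V g + 2 S + 2 Λ g = 0`. -/
def IsRicciSoliton (g : LorentzMetric M) (V : SmoothVectorField M) (Λ : ℝ) : Prop :=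
  ∀ e ∈ atlas R4 M, ∀ y ∈ e.target, ∀ i j : Fin 4,
    lieDerivMetric (g.inChart e) (V.inChart e) i j y + 2 * ricci (g.inChart e) i j y
      + 2 * Λ * g.inChart e y i j = 0

/-- The Ricci tensor has the form `S = a g + b η ⊗ η` with scalar functions `a`, `b` and
`η(X) = g(X, ξ)`. -/
def RicciHasForm (g : LorentzMetric M) (ξ : SmoothVectorField M) (a b : M → ℝ) : Prop :=
  ∀ e ∈ atlas R4 M, ∀ y ∈ e.target, ∀ i j : Fin 4,
    ricci (g.inChart e) i j y = a (e.symm y) * g.inChart e y i j + b (e.symm y) *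
      (lower (g.inChart e) (ξ.inChart e) i y * lower (g.inChart e) (ξ.inChart e) j y)

end Manifold

/-- A Ricci soliton `(g, V, Λ)` is expanding when `Λ` is positive. -/
def SolitonExpanding (Λ : ℝ) : Prop := 0 < Λ

/-- A Ricci soliton `(g, V, Λ)` is steady when `Λ` is zero. -/
def SolitonSteady (Λ : ℝ) : Prop := Λ = 0

/-- A Ricci soliton `(g, V, Λ)` is shrinking when `Λ` is negative. -/
def SolitonShrinking (Λ : ℝ) : Prop := Λ < 0

end Spacetime

end

/-! The hypotheses force λ − κ(σ+3ρ)/2 = 3 everywhere and Λ = −3, so only the shrinking case of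
alternative (2) occurs.

Write h = g + η⊗η. The torse-forming condition says ∇η = h, so η is closed and R(X,Y)ξ = η(Y)X −
η(X)Y (`curv_self`). Tracing, S(·,ξ) = 3η. The field equation gives S = a g + b η⊗η with b = κ(σ+ρ),
hence a − b = 3 and S = 3g + b h. Eliminating r by the trace of the field equation turns a − b = 3
into the first identity.

For Λ, everything is Lie-differentiated along ξ. One has L_ξ g = 2h, L_ξ h = 2h and L_ξ∇ = 2h⊗ξ
(`br_self_nab`), which yields L_ξ R (`br_self_curv`) and, by tracing, L_ξ S = 6h. Comparison with S
= 3g + b h gives ξb = −2b. The soliton equation now reads L_V g = −2μ g − 2b h with μ = Λ + 3.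
Applying [L_ξ, L_V] = L_{[ξ,V]} to g, and then the same identity to the gradient field W obtained
from [V,ξ], gives ξξb + 2ξb = 2μ (`IsUnitTorseForming.soliton`). Since ξb = −2b, the left side is 4b
− 4b = 0, so μ = 0.

The tensor identities are proved for an abstract Levi-Civita connection over a ring of functions.
They are applied to the smooth functions on the target of a chart, and the result is evaluated at a
point. -/

/-- A module of vector fields `E` over a ring of functions `A`, with a nondegenerate metric and its
Levi-Civita connection. -/
structure LeviCivitaModule (A E : Type*) [CommRing A] [Algebra ℝ A] [AddCommGroup E]
    [Module A E] where
  act : E →ₗ[A] Derivation ℝ A A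
  br : E → E → E
  nab : E →ₗ[A] (E →+ E)
  g : E →ₗ[A] E →ₗ[A] A
  g_symm : ∀ X Y, g X Y = g Y X
  nondeg : ∀ X, (∀ Y, g X Y = 0) → X = 0
  nab_smul : ∀ X (a : A) Y, nab X (a • Y) = act X a • Y + a • nab X Y
  torsion : ∀ X Y, br X Y = nab X Y - nab Y X
  compat : ∀ X Y Z, act X (g Y Z) = g (nab X Y) Z + g Y (nab X Z)
  act_br : ∀ X Y a, act (br X Y) a = act X (act Y a) - act Y (act X a)
  jacobi : ∀ X Y Z, br (br X Y) Z = br X (br Y Z) - br Y (br X Z)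

/-! ### Curvature and its symmetries. -/

namespace LeviCivitaModule

variable {A E : Type*} [CommRing A] [Algebra ℝ A] [AddCommGroup E] [Module A E]
  (L : LeviCivitaModule A E)

theorem eq_zero_of_two_mul {a : A} (h : 2 * a = 0) : a = 0 := by
  have h2 : ((2 : ℝ)⁻¹) • (2 * a) = a := by
    rw [← smul_mul_assoc, show (2 : A) = algebraMap ℝ A 2 from (map_ofNat _ 2).symm,
      Algebra.smul_def, ← map_mul]
    norm_num
  rw [← h2, h, smul_zero]

theorem eq_of_inner {X Y : E} (h : ∀ Z, L.g X Z = L.g Y Z) : X = Y :=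
  sub_eq_zero.1 (L.nondeg _ fun Z => by simp [h Z])

theorem br_add_right (X Y Z : E) : L.br X (Y + Z) = L.br X Y + L.br X Z := by
  simp only [L.torsion, map_add, AddMonoidHom.add_apply]; abel

theorem br_sub_right (X Y Z : E) : L.br X (Y - Z) = L.br X Y - L.br X Z := by
  simp only [L.torsion, map_sub, AddMonoidHom.sub_apply]; abel

theorem br_anti (X Y : E) : L.br X Y = - L.br Y X := by
  simp only [L.torsion]; abel

theorem br_add_left (X Y Z : E) : L.br (X + Y) Z = L.br X Z + L.br Y Z := by
  simp only [L.torsion, map_add, AddMonoidHom.add_apply]; abel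

theorem br_smul_left (a : A) (X Y : E) :
    L.br (a • X) Y = a • L.br X Y - L.act Y a • X := by
  simp only [L.torsion, map_smul, L.nab_smul, AddMonoidHom.smul_apply]; module

/-- The curvature `R(X, Y) Z`. -/
def curv (X Y Z : E) : E :=
  L.nab X (L.nab Y Z) - L.nab Y (L.nab X Z) - L.nab (L.br X Y) Z

theorem curv_anti (X Y Z : E) : L.curv X Y Z = - L.curv Y X Z := by
  rw [curv, curv, L.br_anti Y X]
  simp only [map_neg, AddMonoidHom.neg_apply]; abel

theorem curv_add_left (X X' Y Z : E) :
    L.curv (X + X') Y Z = L.curv X Y Z + L.curv X' Y Z := by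
  simp only [curv, L.br_add_left, map_add, AddMonoidHom.add_apply]; abel

theorem curv_smul_left (a : A) (X Y Z : E) : L.curv (a • X) Y Z = a • L.curv X Y Z := by
  simp only [curv, L.br_smul_left, map_smul, map_sub, L.nab_smul, AddMonoidHom.smul_apply,
    AddMonoidHom.sub_apply]
  module

theorem curv_add_right (X Y Z Z' : E) :
    L.curv X Y (Z + Z') = L.curv X Y Z + L.curv X Y Z' := by
  simp only [curv, map_add]; abel

theorem curv_smul_right (a : A) (X Y Z : E) : L.curv X Y (a • Z) = a • L.curv X Y Z := by
  simp only [curv, L.nab_smul, map_add, L.act_br]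
  module

/-- The curvature as a multilinear map. -/
def curvLin (Y : E) : E →ₗ[A] E →ₗ[A] E :=
  LinearMap.mk₂ A (fun X Z => L.curv X Y Z) (fun X X' Z => L.curv_add_left X X' Y Z)
    (fun a X Z => L.curv_smul_left a X Y Z) (fun X Z Z' => L.curv_add_right X Y Z Z')
    (fun a X Z => L.curv_smul_right a X Y Z)

/-- Vanishing torsion turns the Jacobi identity into the first Bianchi identity. -/
theorem bianchi (X Y Z : E) : L.curv X Y Z + L.curv Y Z X + L.curv Z X Y = 0 := by
  have h := L.jacobi X Y Z
  have h1 : L.br X (L.br Y Z) = L.nab X (L.nab Y Z) - L.nab X (L.nab Z Y)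
      - L.nab (L.br Y Z) X := by
    rw [L.torsion X, L.torsion Y Z]; simp only [map_sub]
  have h2 : L.br Y (L.br X Z) = L.nab Y (L.nab X Z) - L.nab Y (L.nab Z X)
      - L.nab (L.br X Z) Y := by
    rw [L.torsion Y, L.torsion X Z]; simp only [map_sub]
  have h3 : L.br (L.br X Y) Z = L.nab (L.br X Y) Z - L.nab Z (L.nab X Y)
      + L.nab Z (L.nab Y X) := by
    have := congrArg (L.nab Z) (L.torsion X Y)
    rw [map_sub] at this
    rw [L.torsion _ Z, this]; abel
  rw [h1, h2, h3] at h
  simp only [curv]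
  rw [L.br_anti Z X, map_neg, AddMonoidHom.neg_apply]
  have := sub_eq_zero.2 h
  rw [← neg_eq_zero, ← this]; abel

/-- By metric compatibility, this is `act_br` applied to the function g(Z,W), on which the curvature
operator vanishes. -/
theorem inner_curv_anti (X Y Z W : E) :
    L.g (L.curv X Y Z) W = - L.g (L.curv X Y W) Z := by
  have h := L.act_br X Y (L.g Z W)
  simp only [L.compat, map_add] at h
  simp only [curv, map_sub, LinearMap.sub_apply]
  rw [L.g_symm (L.nab X (L.nab Y W)), L.g_symm (L.nab Y (L.nab X W)), L.g_symm (L.nab _ W) Z]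
  linear_combination -h

/-- The octahedron argument: a signed sum of four Bianchi identities collapses, through the two skew
symmetries, to twice the difference. -/
theorem curv_pair_symm (X Y Z W : E) : L.g (L.curv X Y Z) W = L.g (L.curv Z W X) Y := by
  have b (X Y Z W : E) : L.g (L.curv X Y Z) W + L.g (L.curv Y Z X) W + L.g (L.curv Z X Y) W = 0 := by
    have := congrArg (fun U => L.g U W) (L.bianchi X Y Z)
    simpa using this
  have a (X Y Z W : E) : L.g (L.curv X Y Z) W = - L.g (L.curv Y X Z) W := by
    rw [L.curv_anti]; simp
  have c := L.inner_curv_anti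
  apply sub_eq_zero.1
  apply eq_zero_of_two_mul
  linear_combination b X Y Z W + b Y Z W X - b Z W X Y - b W X Y Z
    - c Y Z W X - c Z W Y X - a W Y Z X + a W X Z Y - c X W Z Y + a X Z W Y - c Z X W Y
    + a W X Y Z + c X Y W Z + c Y W X Z

end LeviCivitaModule

namespace LeviCivitaModule

variable {A E : Type*} [CommRing A] [Algebra ℝ A] [AddCommGroup E] [Module A E]
  (L : LeviCivitaModule A E)

/-! ### Torse-forming unit fields -/

/-- `ξ` is a unit timelike torse-forming field. -/
structure IsUnitTorseForming (ξ : E) : Prop where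
  unit : L.g ξ ξ = -1
  torse : ∀ X, L.nab X ξ = X + L.g X ξ • ξ

/-- The spatial metric `g + η ⊗ η`. -/
def spatial (ξ X Y : E) : A := L.g X Y + L.g X ξ * L.g Y ξ

variable {L} {ξ : E} (h : L.IsUnitTorseForming ξ)
include h

/-- This is ∇η = h. The symmetry of h is what makes η closed. -/
theorem IsUnitTorseForming.act_eta (X Y : E) :
    L.act X (L.g Y ξ) = L.g (L.nab X Y) ξ + L.spatial ξ X Y := by
  rw [L.compat, h.torse, spatial, map_add, map_smul, smul_eq_mul, L.g_symm X Y]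

theorem IsUnitTorseForming.eta_closed (X Y : E) :
    L.act X (L.g Y ξ) - L.act Y (L.g X ξ) = L.g (L.br X Y) ξ := by
  rw [h.act_eta, h.act_eta, L.torsion, spatial, spatial, L.g_symm Y X]
  simp only [map_sub, LinearMap.sub_apply]; ring

theorem IsUnitTorseForming.spatial_self (X : E) : L.spatial ξ X ξ = 0 := by
  rw [spatial, h.unit]; ring

/-- L_ξ η = 0, because η is closed and η(ξ) is constant. -/
theorem IsUnitTorseForming.act_self_eta (Y : E) :
    L.act ξ (L.g Y ξ) = L.g (L.br ξ Y) ξ := by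
  rw [← h.eta_closed, h.unit]; simp

theorem IsUnitTorseForming.br_self (Y : E) : L.br ξ Y = L.nab ξ Y - Y - L.g Y ξ • ξ := by
  rw [L.torsion, h.torse]; abel

theorem IsUnitTorseForming.act_self_metric (Y Z : E) :
    L.act ξ (L.g Y Z) = L.g (L.br ξ Y) Z + L.g Y (L.br ξ Z) + 2 * L.spatial ξ Y Z := by
  rw [L.compat, h.br_self, h.br_self, spatial]
  simp only [map_sub, LinearMap.sub_apply, map_smul, LinearMap.smul_apply, smul_eq_mul]
  rw [L.g_symm ξ Z]; ring

/-- L_ξ h = 2h follows from L_ξ g = 2h and L_ξ η = 0. -/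
theorem IsUnitTorseForming.act_self_spatial (Y Z : E) :
    L.act ξ (L.spatial ξ Y Z) = L.spatial ξ (L.br ξ Y) Z + L.spatial ξ Y (L.br ξ Z)
      + 2 * L.spatial ξ Y Z := by
  simp only [spatial, map_add, Derivation.leibniz, smul_eq_mul, h.act_self_metric Y Z, h.act_self_eta]
  ring

theorem IsUnitTorseForming.curv_self (X Y : E) :
    L.curv X Y ξ = L.g Y ξ • X - L.g X ξ • Y := by
  have hc := h.eta_closed X Y
  simp only [curv, h.torse, map_add, L.nab_smul]
  rw [← hc, show L.br X Y = L.nab X Y - L.nab Y X from L.torsion X Y]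
  module

/-- Pair symmetry moves ξ into the last slot, where `curv_self` applies. -/
theorem IsUnitTorseForming.curv_self_left (X Y : E) :
    L.curv ξ X Y = L.g X Y • ξ - L.g Y ξ • X := by
  refine L.eq_of_inner fun Z => ?_
  rw [L.curv_pair_symm, h.curv_self]
  simp only [map_sub, LinearMap.sub_apply, map_smul, LinearMap.smul_apply, smul_eq_mul]
  rw [L.g_symm Y X, L.g_symm ξ Z, L.g_symm Z X]
  ring_nf

/-- The Lie derivative of the connection along `ξ` is `2 (g + η ⊗ η) ⊗ ξ`. -/
theorem IsUnitTorseForming.br_self_nab (X Y : E) :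
    L.br ξ (L.nab X Y) = L.nab (L.br ξ X) Y + L.nab X (L.br ξ Y)
      + (2 * L.spatial ξ X Y) • ξ := by
  -- (L_ξ∇)(X,Y) is the second covariant derivative of ξ plus R(ξ,X)Y. Both are known, and each
  -- contributes h(X,Y)ξ once the η(Y)X terms cancel.
  have hc := h.curv_self_left X Y
  rw [curv, sub_sub, sub_eq_iff_eq_add] at hc
  have h1 := h.act_eta X Y
  rw [h.br_self (L.nab X Y), hc, h.br_self Y]
  simp only [map_sub, L.nab_smul, h.torse, h1, spatial]
  module

/-- The Lie derivative of the curvature along `ξ`. -/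
theorem IsUnitTorseForming.br_self_curv (X Y Z : E) :
    L.br ξ (L.curv X Y Z) = L.curv (L.br ξ X) Y Z + L.curv X (L.br ξ Y) Z
      + L.curv X Y (L.br ξ Z) + (2 * L.spatial ξ Y Z) • X - (2 * L.spatial ξ X Z) • Y := by
  have hj : L.br ξ (L.br X Y) = L.br (L.br ξ X) Y + L.br X (L.br ξ Y) := by
    rw [L.jacobi]; abel
  -- L_ξ R is the part of (∇_X L_ξ∇)(Y,Z) that is skew in X, Y. With this formula for ∇h, the
  -- ξ-component is totally symmetric in X, Y, Z and drops out.
  have h2 (X Y Z : E) : L.act X (L.spatial ξ Y Z) = L.spatial ξ (L.nab X Y) Z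
      + L.spatial ξ Y (L.nab X Z) + L.spatial ξ X Y * L.g Z ξ + L.spatial ξ X Z * L.g Y ξ := by
    simp only [spatial, map_add, L.compat X Y Z, Derivation.leibniz, smul_eq_mul, h.act_eta]
    ring
  have h3 : L.spatial ξ (L.br X Y) Z = L.spatial ξ (L.nab X Y) Z - L.spatial ξ (L.nab Y X) Z := by
    simp only [spatial, L.torsion, map_sub, LinearMap.sub_apply]; ring
  have h4 (X : E) (a : A) : L.act X (2 * a) = 2 * L.act X a := by
    rw [two_mul, two_mul, map_add]
  simp only [curv, br_sub_right, h.br_self_nab, hj, map_add, L.nab_smul, AddMonoidHom.add_apply,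
    h2, h3, h4, h.torse]
  have h5 : L.spatial ξ Y X = L.spatial ξ X Y := by
    simp only [spatial, L.g_symm X Y]; ring
  rw [h5]
  module

end LeviCivitaModule

/-! ### Lie derivatives of the metric and the soliton identity. -/

namespace LeviCivitaModule

variable {A E : Type*} [CommRing A] [Algebra ℝ A] [AddCommGroup E] [Module A E]
  (L : LeviCivitaModule A E)

/-- The Lie derivative of a covariant 2-tensor. -/
def lie (X : E) (T : E → E → A) (Y Z : E) : A :=
  L.act X (T Y Z) - T (L.br X Y) Z - T Y (L.br X Z)

theorem lie_lie (X Y U W : E) :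
    L.lie X (L.lie Y fun U W => L.g U W) U W - L.lie Y (L.lie X fun U W => L.g U W) U W
      = L.lie (L.br X Y) (fun U W => L.g U W) U W := by
  simp only [lie, L.act_br, L.jacobi, map_sub, LinearMap.sub_apply]
  ring

theorem lie_add_left (X X' Y Z : E) : L.lie (X + X') (fun U W => L.g U W) Y Z =
    L.lie X (fun U W => L.g U W) Y Z + L.lie X' (fun U W => L.g U W) Y Z := by
  simp only [lie, L.br_add_left, map_add, LinearMap.add_apply, Derivation.add_apply]
  ring

theorem lie_const_smul_left (c : ℝ) (X Y Z : E) :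
    L.lie (algebraMap ℝ A c • X) (fun U W => L.g U W) Y Z =
      algebraMap ℝ A c * L.lie X (fun U W => L.g U W) Y Z := by
  simp only [lie, L.br_smul_left, map_smul, Derivation.map_algebraMap, zero_smul,
    LinearMap.smul_apply, Derivation.smul_apply, smul_eq_mul, sub_zero]
  ring

variable {L} {ξ : E} (h : L.IsUnitTorseForming ξ)
include h

theorem IsUnitTorseForming.lie_self (Y Z : E) :
    L.lie ξ (fun U W => L.g U W) Y Z = 2 * L.spatial ξ Y Z := by
  simp only [lie, h.act_self_metric Y Z]; ring

/-- If `L_V g = -2 μ g - 2 b (g + η ⊗ η)`, then `b` satisfies `ξ ξ b + 2 ξ b = 2 μ` wherever the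
spatial metric does not vanish. -/
theorem IsUnitTorseForming.soliton {V : E} {b : A} {μ : ℝ}
    (hV : ∀ Y Z, L.lie V (fun U W => L.g U W) Y Z =
      - (2 * algebraMap ℝ A μ * L.g Y Z) - 2 * b * L.spatial ξ Y Z) (Y Z : E) :
    (L.act ξ (L.act ξ b) + 2 * L.act ξ b - 2 * algebraMap ℝ A μ) * L.spatial ξ Y Z = 0 := by
  have two (D : Derivation ℝ A A) (a : A) : D (2 * a) = 2 * D a := by
    rw [two_mul, two_mul, map_add]
  set m := algebraMap ℝ A μ with hm
  have dm (D : Derivation ℝ A A) : D m = 0 := D.map_algebraMap μ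
  -- The correction by 2μξ makes W the gradient of f = η(V): since h(·,ξ) = 0, the soliton equation
  -- has only its μ term on (X,ξ), and η is closed.
  set W := L.br V ξ - (2 * m) • ξ with hW
  have hbr : L.br V ξ = W + (2 * m) • ξ := by rw [hW]; abel
  set f := L.g V ξ with hf
  have hgrad (X : E) : L.g W X = L.act X f := by
    have h1 := h.eta_closed V X
    have h2 := hV X ξ
    rw [h.spatial_self, lie] at h2
    rw [hW, map_sub, map_smul, LinearMap.sub_apply, LinearMap.smul_apply, smul_eq_mul,
      L.g_symm ξ X, L.g_symm _ X]
    linear_combination h1 - h2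
  -- L_ξ η = 0 on V gives ξf = −g(W + 2μξ, ξ) = −ξf + 2μ.
  have hξf : L.act ξ f = m := by
    have h1 := h.act_self_eta V
    rw [L.br_anti, hbr, map_neg, map_add, map_smul] at h1
    simp only [LinearMap.neg_apply, LinearMap.add_apply, LinearMap.smul_apply, smul_eq_mul,
      hgrad, h.unit] at h1
    apply sub_eq_zero.1
    apply eq_zero_of_two_mul
    linear_combination h1
  have hηW : L.g W ξ = m := by rw [hgrad, hξf]
  -- ξf is constant, so L_ξ df = 0; comparing with df = g(W,·) and L_ξ g = 2h determines [ξ,W].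
  have hbrW : L.br ξ W = algebraMap ℝ A (-2) • W + algebraMap ℝ A (-2 * μ) • ξ := by
    refine L.eq_of_inner fun X => ?_
    have h1 := h.act_self_metric W X
    have h2 := L.act_br ξ X f
    rw [hgrad, hgrad, spatial, hηW, h2, hξf, dm, hgrad] at h1
    simp only [map_add, map_smul, LinearMap.add_apply, LinearMap.smul_apply, smul_eq_mul, hgrad,
      map_mul, map_neg, map_ofNat, ← hm]
    rw [L.g_symm ξ X]
    linear_combination -h1
  have hbrV : L.br ξ V = algebraMap ℝ A (-1) • W + algebraMap ℝ A (-2 * μ) • ξ := by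
    rw [L.br_anti, hbr]
    simp only [map_mul, map_neg, map_ofNat, ← hm, map_one]
    module
  have hVη (Y : E) : L.act V (L.g Y ξ) = L.g (L.br V Y) ξ + L.act Y f := by
    rw [← h.eta_closed V Y]; ring
  have hWη (Y : E) : L.act W (L.g Y ξ) = L.g (L.br W Y) ξ := by
    rw [← h.eta_closed W Y, hηW, dm]; ring
  have hdf (Y : E) : L.act ξ (L.act Y f) = L.act (L.br ξ Y) f := by
    rw [L.act_br, hξf, dm]; ring
  have e1 : L.lie ξ (fun U W => L.g U W) = fun Y Z => 2 * L.spatial ξ Y Z := by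
    ext; rw [h.lie_self]
  have e2 : L.lie V (fun U W => L.g U W) = fun Y Z =>
      - (2 * m * L.g Y Z) - 2 * b * L.spatial ξ Y Z := by
    ext; rw [hV]
  have hVg (Y Z : E) := hV Y Z
  simp only [lie] at hVg
  -- Since [ξ,V] = −W − 2μξ, the commutator of L_ξ and L_V on g determines L_W g.
  have e3 : L.lie W (fun U W => L.g U W) = fun Y Z =>
      2 * L.act ξ b * L.spatial ξ Y Z - 4 * m * L.g Y Z
        + 2 * (L.act Y f * L.g Z ξ + L.act Z f * L.g Y ξ) := by
    ext Y Z
    have h1 := L.lie_lie ξ V Y Z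
    have h2 := h.act_self_metric Y Z
    have h3 := h.act_self_spatial Y Z
    rw [hbrV, L.lie_add_left, L.lie_const_smul_left, L.lie_const_smul_left, h.lie_self, e1, e2] at h1
    have h4 := hVg Y Z
    rw [sub_sub, sub_eq_iff_eq_add] at h4
    have h5 : L.act V (L.spatial ξ Y Z) = L.spatial ξ (L.br V Y) Z + L.spatial ξ Y (L.br V Z)
        - (2 * m * L.g Y Z) - 2 * b * L.spatial ξ Y Z
        + L.act Y f * L.g Z ξ + L.act Z f * L.g Y ξ := by
      simp only [spatial, map_add, Derivation.leibniz, smul_eq_mul, h4, hVη]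
      ring
    simp only [lie, map_sub, map_neg, mul_assoc, two, Derivation.leibniz, smul_eq_mul, h2, h3, h5,
      dm, map_mul, map_ofNat, map_one, ← hm] at h1
    simp only [lie]
    linear_combination h1
  -- [ξ,W] is a constant combination of W and ξ, so this second commutator involves only known Lie
  -- derivatives. The df and g terms cancel, leaving a multiple of h.
  have h1 := L.lie_lie ξ W Y Z
  have h2 := h.act_self_metric Y Z
  have h3 := h.act_self_spatial Y Z
  rw [hbrW, L.lie_add_left, L.lie_const_smul_left, L.lie_const_smul_left, h.lie_self, e1] at h1
  have h4 := congrFun (congrFun e3 Y) Z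
  rw [e3] at h1
  simp only [lie] at h4
  rw [sub_sub, sub_eq_iff_eq_add] at h4
  have h5 : L.act W (L.spatial ξ Y Z) = L.spatial ξ (L.br W Y) Z + L.spatial ξ Y (L.br W Z)
      + 2 * L.act ξ b * L.spatial ξ Y Z - 4 * m * L.g Y Z
        + 2 * (L.act Y f * L.g Z ξ + L.act Z f * L.g Y ξ) := by
    simp only [spatial, map_add, Derivation.leibniz, smul_eq_mul, h4, hWη]
    ring
  have four (D : Derivation ℝ A A) (a : A) : D (4 * a) = 4 * D a := by
    rw [show (4 : A) = 2 * 2 by norm_num, mul_assoc, two, two, mul_assoc]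
  simp only [lie, map_sub, map_add, mul_assoc, two, four, Derivation.leibniz, smul_eq_mul, h2, h3,
    h5, dm, map_mul, map_neg, map_ofNat, hdf, h.act_self_eta, ← hm] at h1
  apply eq_zero_of_two_mul
  linear_combination h1

end LeviCivitaModule

/-! ### The Levi-Civita connection of a metric in coordinates. -/

noncomputable section

/-- A metric in coordinates: commuting derivations, and a symmetric matrix with its inverse. -/
structure CoordMetric (A : Type*) [CommRing A] [Algebra ℝ A] where
  D : Fin 4 → Derivation ℝ A A
  comm : ∀ i j a, D i (D j a) = D j (D i a)
  G : Matrix (Fin 4) (Fin 4) A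
  H : Matrix (Fin 4) (Fin 4) A
  symm : ∀ i j, G i j = G j i
  inv : G * H = 1

namespace CoordMetric

variable {A : Type*} [CommRing A] [Algebra ℝ A] (C : CoordMetric A)

/-- The Christoffel symbols. -/
def chr (k i j : Fin 4) : A :=
  algebraMap ℝ A (1 / 2) * ∑ l, C.H k l * (C.D i (C.G j l) + C.D j (C.G i l) - C.D l (C.G i j))

theorem chr_symm (k i j : Fin 4) : C.chr k i j = C.chr k j i := by
  simp only [chr]
  congr 1
  refine Finset.sum_congr rfl fun l _ => ?_
  rw [C.symm i j]; ring

theorem lower_chr (l i j : Fin 4) : ∑ k, C.G l k * C.chr k i j =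
    algebraMap ℝ A (1 / 2) * (C.D i (C.G j l) + C.D j (C.G i l) - C.D l (C.G i j)) := by
  have h (m : Fin 4) : ∑ k, C.G l k * C.H k m = if l = m then 1 else 0 := by
    have := congrFun (congrFun C.inv l) m
    rwa [Matrix.mul_apply, Matrix.one_apply] at this
  simp only [chr, mul_left_comm (C.G l _), ← Finset.mul_sum]
  congr 1
  simp only [Finset.mul_sum]
  rw [Finset.sum_comm]
  simp only [← mul_assoc, ← Finset.sum_mul, h]
  simp

theorem deriv_metric (i j l : Fin 4) :
    C.D i (C.G j l) = ∑ k, C.G l k * C.chr k i j + ∑ k, C.G j k * C.chr k i l := by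
  have h : algebraMap ℝ A (1 / 2) * 2 = 1 := by
    rw [show (2 : A) = algebraMap ℝ A 2 from (map_ofNat _ 2).symm, ← map_mul]; norm_num
  rw [C.lower_chr, C.lower_chr, C.symm l j, C.symm i l, C.symm i j]
  linear_combination -(C.D i (C.G j l)) * h

/-- Vector fields act on functions. -/
def act : (Fin 4 → A) →ₗ[A] Derivation ℝ A A := Fintype.linearCombination A C.D

theorem act_apply (X : Fin 4 → A) (a : A) : C.act X a = ∑ i, X i * C.D i a := by
  simp only [act, Fintype.linearCombination_apply, Fin.sum_univ_four, Derivation.add_apply,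
    Derivation.smul_apply, smul_eq_mul]

/-- The covariant derivative. -/
def nab : (Fin 4 → A) →ₗ[A] ((Fin 4 → A) →+ (Fin 4 → A)) where
  toFun X :=
    { toFun := fun Y k => C.act X (Y k) + ∑ i, ∑ j, X i * (C.chr k i j * Y j)
      map_zero' := by ext; simp
      map_add' := fun Y Z => by
        ext k
        simp only [Pi.add_apply, map_add, mul_add, Finset.sum_add_distrib]
        ring }
  map_add' X Y := by
    refine AddMonoidHom.ext fun Z => funext fun k => ?_
    simp only [AddMonoidHom.coe_mk, ZeroHom.coe_mk, AddMonoidHom.add_apply, Pi.add_apply, map_add,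
      Derivation.add_apply, add_mul, Finset.sum_add_distrib]
    ring
  map_smul' a X := by
    refine AddMonoidHom.ext fun Z => funext fun k => ?_
    simp only [AddMonoidHom.coe_mk, ZeroHom.coe_mk, AddMonoidHom.smul_apply, Pi.smul_apply,
      map_smul, Derivation.smul_apply, smul_eq_mul, RingHom.id_apply, mul_assoc, ← Finset.mul_sum]
    ring

theorem nab_apply (X Y : Fin 4 → A) (k : Fin 4) :
    C.nab X Y k = C.act X (Y k) + ∑ i, ∑ j, X i * (C.chr k i j * Y j) := rfl

/-- The metric on vector fields. -/
def metric : (Fin 4 → A) →ₗ[A] (Fin 4 → A) →ₗ[A] A := Matrix.toLinearMap₂' A C.G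

theorem metric_apply (X Y : Fin 4 → A) :
    C.metric X Y = ∑ i, ∑ j, C.G i j * X i * Y j := by
  simp only [metric, Matrix.toLinearMap₂'_apply, smul_eq_mul]
  refine Finset.sum_congr rfl fun i _ => Finset.sum_congr rfl fun j _ => ?_
  ring

theorem metric_symm (X Y : Fin 4 → A) : C.metric X Y = C.metric Y X := by
  rw [metric_apply, metric_apply, Finset.sum_comm]
  refine Finset.sum_congr rfl fun i _ => Finset.sum_congr rfl fun j _ => ?_
  rw [C.symm]; ring

theorem metric_single (i j : Fin 4) :
    C.metric (Pi.single i 1) (Pi.single j 1) = C.G i j := by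
  simp [metric_apply, Pi.single_apply]

theorem metric_nab (X Y Z : Fin 4 → A) : C.metric (C.nab X Y) Z =
    C.metric (fun k => C.act X (Y k)) Z
      + ∑ i, ∑ j, ∑ l, X i * Y j * Z l * ∑ k, C.G l k * C.chr k i j := by
  rw [show C.nab X Y = (fun k => C.act X (Y k)) + fun k => ∑ i, ∑ j, X i * (C.chr k i j * Y j) from
    rfl, map_add, LinearMap.add_apply]
  congr 1
  rw [C.metric_symm, metric_apply]
  simp only [Finset.mul_sum]
  rw [Finset.sum_comm_cycle]
  refine Finset.sum_congr rfl fun i _ => ?_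
  rw [Finset.sum_comm_cycle]
  refine Finset.sum_congr rfl fun j _ => ?_
  refine Finset.sum_congr rfl fun l _ => Finset.sum_congr rfl fun k _ => ?_
  ring

theorem act_metric (X Y Z : Fin 4 → A) :
    C.act X (C.metric Y Z) = C.metric (C.nab X Y) Z + C.metric Y (C.nab X Z) := by
  rw [C.metric_symm Y (C.nab X Z), metric_nab, metric_nab, C.metric_symm _ Y, metric_apply,
    metric_apply, metric_apply]
  simp only [map_sum, Derivation.leibniz, smul_eq_mul, C.act_apply X (C.G _ _), C.deriv_metric,
    Finset.sum_add_distrib, Finset.mul_sum, mul_add]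
  have e1 : ∑ i, ∑ j, ∑ l, ∑ k, X i * Y j * Z l * (C.G l k * C.chr k i j) =
      ∑ j, ∑ l, ∑ i, ∑ k, Z l * (Y j * (X i * (C.G l k * C.chr k i j))) := by
    rw [Finset.sum_comm]
    refine Finset.sum_congr rfl fun j _ => ?_
    rw [Finset.sum_comm]
    refine Finset.sum_congr rfl fun l _ => Finset.sum_congr rfl fun i _ =>
      Finset.sum_congr rfl fun k _ => ?_
    ring
  have e2 : ∑ i, ∑ l, ∑ j, ∑ k, X i * Z l * Y j * (C.G j k * C.chr k i l) =
      ∑ j, ∑ l, ∑ i, ∑ k, Z l * (Y j * (X i * (C.G j k * C.chr k i l))) := by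
    rw [Finset.sum_comm_cycle]
    refine Finset.sum_congr rfl fun j _ => ?_
    rw [Finset.sum_comm]
    refine Finset.sum_congr rfl fun l _ => Finset.sum_congr rfl fun i _ =>
      Finset.sum_congr rfl fun k _ => ?_
    ring
  rw [e1, e2]
  have e4 : ∑ i, ∑ j, C.G i j * C.act X (Y i) * Z j = ∑ i, ∑ j, Z j * (C.G i j * C.act X (Y i)) := by
    simp only [mul_comm]
  rw [e4]
  ring_nf

/-- The second-order terms are symmetric in X and Y because the coordinate derivations commute. -/
theorem act_bracket (X Y : Fin 4 → A) (a : A) :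
    C.act (fun k => C.act X (Y k) - C.act Y (X k)) a
      = C.act X (C.act Y a) - C.act Y (C.act X a) := by
  have h (X Y : Fin 4 → A) : C.act X (C.act Y a) = ∑ k, C.act X (Y k) * C.D k a
      + ∑ k, ∑ i, Y k * X i * C.D i (C.D k a) := by
    rw [C.act_apply Y a]
    simp only [map_sum, Derivation.leibniz, smul_eq_mul, C.act_apply X (C.D _ _), Finset.mul_sum,
      Finset.sum_add_distrib]
    rw [add_comm]
    congr 1
    · exact Finset.sum_congr rfl fun _ _ => mul_comm _ _
    · simp only [mul_assoc]
  have h2 : ∑ k, ∑ i, Y k * X i * C.D i (C.D k a) = ∑ k, ∑ i, X k * Y i * C.D i (C.D k a) := by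
    rw [Finset.sum_comm]
    refine Finset.sum_congr rfl fun i _ => Finset.sum_congr rfl fun j _ => ?_
    rw [C.comm]; ring
  rw [h X Y, h Y X, h2, C.act_apply]
  simp only [sub_mul, Finset.sum_sub_distrib]
  ring

/-- The Levi-Civita connection of a metric in coordinates. -/
def leviCivita : LeviCivitaModule A (Fin 4 → A) where
  act := C.act
  br X Y k := C.act X (Y k) - C.act Y (X k)
  nab := C.nab
  g := C.metric
  g_symm := C.metric_symm
  nondeg X h := by
    have h1 : Matrix.vecMul X C.G = 0 := by
      ext j
      have := h (Pi.single j 1)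
      rwa [metric, Matrix.toLinearMap₂'_apply', Matrix.dotProduct_mulVec, dotProduct_single,
        mul_one] at this
    rw [← Matrix.vecMul_one X, ← C.inv, ← Matrix.vecMul_vecMul, h1, Matrix.zero_vecMul]
  nab_smul X a Y := by
    ext k
    simp only [nab_apply, Pi.add_apply, Pi.smul_apply, smul_eq_mul, Derivation.leibniz, mul_add,
      Finset.mul_sum]
    rw [add_comm (a * _), mul_comm (Y k), add_assoc]
    congr 2
    refine Finset.sum_congr rfl fun i _ => Finset.sum_congr rfl fun j _ => ?_
    ring
  torsion X Y := by
    ext k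
    rw [Pi.sub_apply, nab_apply, nab_apply, Finset.sum_comm (f := fun i j => Y i * _)]
    have : ∑ i, ∑ j, X i * (C.chr k i j * Y j) = ∑ i, ∑ j, Y j * (C.chr k j i * X i) := by
      refine Finset.sum_congr rfl fun i _ => Finset.sum_congr rfl fun j _ => ?_
      rw [C.chr_symm]; ring
    rw [this]; ring
  compat := C.act_metric
  act_br := C.act_bracket
  jacobi X Y Z := by
    ext k
    simp only [Pi.sub_apply, C.act_bracket, map_sub]
    abel

end CoordMetric

end

/-! ### Ricci tensor, traces and the soliton constant. -/

noncomputable section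

namespace LeviCivitaModule

variable {A E : Type*} [CommRing A] [Algebra ℝ A] [AddCommGroup E] [Module A E]
  (L : LeviCivitaModule A E)

theorem br_smul_right (a : A) (X Y : E) :
    L.br X (a • Y) = a • L.br X Y + L.act X a • Y := by
  rw [L.br_anti, L.br_smul_left, L.br_anti X Y]; module

/-- The Lie derivative of the metric as a bilinear map. -/
def lieMetric (X : E) : E →ₗ[A] E →ₗ[A] A :=
  LinearMap.mk₂ A (L.lie X fun U W => L.g U W)
    (fun Y Y' Z => by
      simp only [lie, L.br_add_right, map_add, LinearMap.add_apply]; ring)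
    (fun a Y Z => by
      simp only [lie, L.br_smul_right, map_add, map_smul, LinearMap.add_apply,
        LinearMap.smul_apply, smul_eq_mul, Derivation.leibniz]
      ring)
    (fun Y Z Z' => by
      simp only [lie, L.br_add_right, map_add]; ring)
    (fun a Y Z => by
      simp only [lie, L.br_smul_right, map_add, map_smul, smul_eq_mul, Derivation.leibniz]
      ring)

theorem lieMetric_apply (X Y Z : E) :
    L.lieMetric X Y Z = L.lie X (fun U W => L.g U W) Y Z := rfl

/-- The 1-form metrically equivalent to a field. -/
def eta (ξ : E) : E →ₗ[A] A := L.g.flip ξ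

end LeviCivitaModule

namespace CoordMetric

theorem sum_single_mul {A : Type*} [CommRing A] (φ : (Fin 4 → A) →ₗ[A] A) (Y : Fin 4 → A) :
    ∑ i, φ (Pi.single i 1) * Y i = φ Y := by
  conv_rhs => rw [LinearMap.pi_apply_eq_sum_univ φ Y]
  refine Finset.sum_congr rfl fun i _ => ?_
  rw [smul_eq_mul, mul_comm]
  congr 2
  ext j
  simp [Pi.single_apply, eq_comm]

theorem bilin_ext {A : Type*} [CommRing A] {S T : (Fin 4 → A) →ₗ[A] (Fin 4 → A) →ₗ[A] A}
    (h : ∀ i j, S (Pi.single i 1) (Pi.single j 1) = T (Pi.single i 1) (Pi.single j 1)) : S = T := by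
  refine (Pi.basisFun A (Fin 4)).ext fun i => (Pi.basisFun A (Fin 4)).ext fun j => ?_
  simpa using h i j

variable {A : Type*} [CommRing A] [Algebra ℝ A] (C : CoordMetric A)

/-- The components of the curvature tensor. -/
def riem (i j k l : Fin 4) : A :=
  C.D i (C.chr l j k) - C.D j (C.chr l i k)
    + ∑ m, (C.chr l i m * C.chr m j k - C.chr l j m * C.chr m i k)

/-- The components of the Ricci tensor. -/
def ric (j k : Fin 4) : A := ∑ i, C.riem i j k i

theorem act_single (i : Fin 4) : C.act (Pi.single i 1) = C.D i := by
  simp [act]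

theorem nab_single (i j k : Fin 4) :
    C.nab (Pi.single i 1) (Pi.single j 1) k = C.chr k i j := by
  rw [nab_apply, act_single]
  simp [Pi.single_apply, apply_ite (C.D i)]

theorem br_single (X : Fin 4 → A) (i k : Fin 4) :
    C.leviCivita.br X (Pi.single i 1) k = - C.D i (X k) := by
  change C.act X _ - C.act (Pi.single i 1) (X k) = _
  rw [act_single]
  simp [Pi.single_apply, apply_ite (C.act X)]

theorem curv_single (i j k l : Fin 4) :
    C.leviCivita.curv (Pi.single i 1) (Pi.single j 1) (Pi.single k 1) l = C.riem i j k l := by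
  have hb : C.leviCivita.br (Pi.single i 1) (Pi.single j 1) = 0 := by
    ext k
    rw [br_single]
    simp [Pi.single_apply, apply_ite (C.D j)]
  have hn (i j : Fin 4) : C.leviCivita.nab (Pi.single i 1) (Pi.single j 1)
      = fun k => C.chr k i j := funext fun k => C.nab_single i j k
  rw [LeviCivitaModule.curv, hb, hn, hn]
  change C.nab _ _ l - C.nab _ _ l - C.leviCivita.nab 0 _ l = _
  rw [map_zero, nab_apply, nab_apply, act_single, act_single]
  simp [Pi.single_apply, riem]
  ring

/-- The Ricci tensor as a bilinear map. -/
def ricciForm : (Fin 4 → A) →ₗ[A] (Fin 4 → A) →ₗ[A] A :=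
  ∑ i, LinearMap.mk₂ A (fun Y Z => C.leviCivita.curv (Pi.single i 1) Y Z i)
    (fun Y Y' Z => by
      rw [C.leviCivita.curv_anti, C.leviCivita.curv_add_left, C.leviCivita.curv_anti _ Y,
        C.leviCivita.curv_anti _ Y']
      simp only [Pi.neg_apply, Pi.add_apply]; ring)
    (fun a Y Z => by
      rw [C.leviCivita.curv_anti, C.leviCivita.curv_smul_left, C.leviCivita.curv_anti _ Y]
      simp)
    (fun Y Z Z' => by rw [C.leviCivita.curv_add_right, Pi.add_apply])
    (fun a Y Z => by rw [C.leviCivita.curv_smul_right, Pi.smul_apply])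

theorem ricciForm_apply (Y Z : Fin 4 → A) :
    C.ricciForm Y Z = ∑ i, C.leviCivita.curv (Pi.single i 1) Y Z i := by
  simp [ricciForm]

theorem ricciForm_single (j k : Fin 4) :
    C.ricciForm (Pi.single j 1) (Pi.single k 1) = C.ric j k := by
  simp only [ricciForm_apply, curv_single, ric]

/-- The trace commutes with the Lie derivative. -/
theorem trace_br (X : Fin 4 → A) (T : (Fin 4 → A) →ₗ[A] (Fin 4 → A)) :
    ∑ i, (C.leviCivita.br X (T (Pi.single i 1)) i
      - T (C.leviCivita.br X (Pi.single i 1)) i) = C.act X (∑ i, T (Pi.single i 1) i) := by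
  have h1 (i : Fin 4) : T (C.leviCivita.br X (Pi.single i 1)) i
      = - ∑ k, C.D i (X k) * T (Pi.single k 1) i := by
    have := sum_single_mul ((LinearMap.proj i).comp T) (C.leviCivita.br X (Pi.single i 1))
    simp only [LinearMap.comp_apply, LinearMap.proj_apply, br_single] at this
    rw [← this, ← Finset.sum_neg_distrib]
    exact Finset.sum_congr rfl fun k _ => by ring
  have h2 (i : Fin 4) : C.leviCivita.br X (T (Pi.single i 1)) i
      = C.act X (T (Pi.single i 1) i) - ∑ k, T (Pi.single i 1) k * C.D k (X i) := by
    change C.act X _ - C.act _ _ = _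
    rw [C.act_apply (T _)]
  simp only [h1, h2, map_sum, Finset.sum_sub_distrib, Finset.sum_neg_distrib]
  -- The two sums left are the traces of the two products of T with the Jacobian of X, so they
  -- cancel.
  rw [Finset.sum_comm (f := fun i k => C.D i (X k) * _)]
  simp only [mul_comm]
  ring

theorem lie_single (X : Fin 4 → A) (i j : Fin 4) :
    C.leviCivita.lie X (fun U W => C.leviCivita.g U W) (Pi.single i 1) (Pi.single j 1) =
      ∑ k, (X k * C.D k (C.G i j) + C.G k j * C.D i (X k) + C.G i k * C.D j (X k)) := by
  have hb (i : Fin 4) : C.leviCivita.br X (Pi.single i 1) = fun k => - C.D i (X k) :=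
    funext fun k => C.br_single X i k
  rw [LeviCivitaModule.lie, hb, hb]
  change C.act X (C.metric _ _) - C.metric _ _ - C.metric _ _ = _
  rw [metric_single, act_apply, metric_apply, metric_apply]
  simp [Pi.single_apply, Finset.sum_add_distrib]

/-- A Ricci soliton on a perfect fluid spacetime with unit torse-forming velocity has soliton
constant `-3`. -/
theorem soliton_const {ξ V : Fin 4 → A} {a b : A} {c : ℝ}
    (hunit : ∑ i, ∑ j, C.G i j * ξ i * ξ j = -1)
    (htorse : ∀ i k, C.D i (ξ k) + ∑ j, C.chr k i j * ξ j =
      (if i = k then 1 else 0) + (∑ j, C.G i j * ξ j) * ξ k)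
    (hric : ∀ i j, C.ric i j = a * C.G i j
      + b * ((∑ k, C.G i k * ξ k) * ∑ k, C.G j k * ξ k))
    (hsol : ∀ i j, ∑ k, (V k * C.D k (C.G i j) + C.G k j * C.D i (V k) + C.G i k * C.D j (V k))
      + 2 * C.ric i j + 2 * algebraMap ℝ A c * C.G i j = 0) :
    a - b = 3 ∧ algebraMap ℝ A (c + 3) = 0 := by
  set L := C.leviCivita with hL
  have heta (i : Fin 4) : L.g (Pi.single i 1) ξ = ∑ k, C.G i k * ξ k := by
    change C.metric _ _ = _
    rw [metric_apply]
    simp [Pi.single_apply]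
  have h : L.IsUnitTorseForming ξ := by
    refine ⟨by rw [← hunit, ← metric_apply]; rfl, fun X => funext fun k => ?_⟩
    have e : L.nab X ξ k = ∑ i, X i * (C.D i (ξ k) + ∑ j, C.chr k i j * ξ j) := by
      change C.nab _ _ _ = _
      rw [nab_apply, act_apply]
      simp only [mul_add, Finset.mul_sum, Finset.sum_add_distrib]
    have e2 : L.g X ξ = ∑ i, X i * ∑ j, C.G i j * ξ j := by
      have := sum_single_mul (L.eta ξ) X
      change ∑ i, L.g _ ξ * _ = L.g X ξ at this
      rw [← this]
      exact Finset.sum_congr rfl fun i _ => by rw [heta, mul_comm]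
    rw [e, Pi.add_apply, Pi.smul_apply, e2]
    simp only [htorse, mul_add, Finset.sum_add_distrib, smul_eq_mul, ← mul_assoc]
    rw [Finset.sum_mul]
    simp
  have trace_eta (Y : Fin 4 → A) : ∑ i, L.g (Pi.single i 1) Y * ξ i = L.g ξ Y := by
    exact sum_single_mul (L.g.flip Y) ξ
  -- The endomorphism Y ↦ Y + η(Y)ξ has trace 4 − 1 = 3, which is invertible, so a multiple of h
  -- vanishes only if its coefficient does.
  have trace_spatial (d : A) (hd : ∀ Y Z, d * L.spatial ξ Y Z = 0) : d = 0 := by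
    have h1 (Y : Fin 4 → A) : d • (Y + L.g Y ξ • ξ) = 0 := by
      refine L.nondeg _ fun Z => ?_
      rw [← hd Y Z, LeviCivitaModule.spatial, L.g_symm Z ξ]
      simp only [map_smul, map_add, LinearMap.smul_apply, LinearMap.add_apply, smul_eq_mul]
    have h2 : ∑ i, (d • ((Pi.single i 1 : Fin 4 → A) + L.g (Pi.single i 1) ξ • ξ)) i = d * 3 := by
      simp only [Pi.smul_apply, Pi.add_apply, smul_eq_mul, ← Finset.mul_sum,
        Finset.sum_add_distrib, trace_eta, h.unit]
      simp
      norm_num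
    simp only [h1, Pi.zero_apply, Finset.sum_const_zero] at h2
    have h3 : (3 : A) * algebraMap ℝ A (1 / 3) = 1 := by
      rw [show (3 : A) = algebraMap ℝ A 3 from (map_ofNat _ 3).symm, ← map_mul]; norm_num
    linear_combination -d * h3 - algebraMap ℝ A (1 / 3) * h2
  have ricF : C.ricciForm = a • C.metric + b • (L.eta ξ).smulRight (L.eta ξ) := by
    refine bilin_ext fun i j => ?_
    rw [ricciForm_single, hric, ← heta, ← heta, ← C.metric_single]
    rfl
  have ricE (Y Z : Fin 4 → A) : C.ricciForm Y Z = a * L.g Y Z + b * (L.g Y ξ * L.g Z ξ) := by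
    rw [ricF]; rfl
  -- The trace of X ↦ η(Y)X − η(X)Y is 4η(Y) − η(Y).
  have ricξ (Y : Fin 4 → A) : C.ricciForm Y ξ = 3 * L.g Y ξ := by
    rw [ricciForm_apply]
    simp only [← hL, h.curv_self, Pi.sub_apply, Pi.smul_apply, Pi.single_eq_same, smul_eq_mul]
    have : ∑ i, L.g (Pi.single i 1) ξ * Y i = L.g Y ξ := by
      exact sum_single_mul (L.eta ξ) Y
    rw [Finset.sum_sub_distrib, this]
    simp
    ring
  have hab : a - b = 3 := by
    have := ricE ξ ξ
    rw [ricξ, h.unit] at this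
    linear_combination this
  have ricP (Y Z : Fin 4 → A) : C.ricciForm Y Z = 3 * L.g Y Z + b * L.spatial ξ Y Z := by
    rw [ricE, LeviCivitaModule.spatial, ← hab]; ring
  refine ⟨hab, ?_⟩
  -- L_ξ commutes with the trace, and the trace of X ↦ 2h(Y,Z)X − 2h(X,Z)Y is 8h − 2h.
  have hlieR (Y Z : Fin 4 → A) : L.act ξ (C.ricciForm Y Z) = C.ricciForm (L.br ξ Y) Z
      + C.ricciForm Y (L.br ξ Z) + 6 * L.spatial ξ Y Z := by
    have h1 := C.trace_br ξ ((L.curvLin Y).flip Z)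
    have h2 (X : Fin 4 → A) : (L.curvLin Y).flip Z X = L.curv X Y Z := rfl
    simp only [h2, ← hL, h.br_self_curv] at h1
    change _ = L.act ξ _ at h1
    rw [ricciForm_apply, ricciForm_apply, ricciForm_apply, ← hL, ← h1]
    simp only [Pi.add_apply, Pi.sub_apply, Pi.smul_apply, smul_eq_mul, Pi.single_eq_same,
      Finset.sum_add_distrib, Finset.sum_sub_distrib, mul_assoc, ← Finset.mul_sum]
    have h3 : ∑ i, L.spatial ξ (Pi.single i 1) Z * Y i = L.spatial ξ Y Z := by
      have := sum_single_mul (L.g.flip Z + L.g Z ξ • L.eta ξ) Y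
      simp only [LinearMap.add_apply, LinearMap.smul_apply, LinearMap.flip_apply, smul_eq_mul,
        LeviCivitaModule.eta, mul_comm (L.g Z ξ)] at this
      exact this
    rw [h3]
    simp
    ring
  have three (D : Derivation ℝ A A) (x : A) : D (3 * x) = 3 * D x := by
    rw [show (3 : A) = 1 + 1 + 1 by norm_num]
    simp only [add_mul, one_mul, map_add]
  -- Compare L_ξ S = 6h with L_ξ(3g + b h) = 6h + (ξb + 2b)h.
  have hξb : L.act ξ b + 2 * b = 0 := by
    refine trace_spatial _ fun Y Z => ?_
    have h1 := hlieR Y Z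
    rw [ricP, ricP, ricP] at h1
    simp only [map_add, three, Derivation.leibniz, smul_eq_mul, h.act_self_metric Y Z,
      h.act_self_spatial Y Z] at h1
    linear_combination h1
  have hlieV (Y Z : Fin 4 → A) : L.lie V (fun U W => L.g U W) Y Z =
      - (2 * algebraMap ℝ A (c + 3) * L.g Y Z) - 2 * b * L.spatial ξ Y Z := by
    have h1 : L.lieMetric V = - ((2 : A) • C.ricciForm) - (2 * algebraMap ℝ A c) • C.metric := by
      refine bilin_ext fun i j => ?_
      have h1 := hsol i j
      rw [← C.lie_single, ← ricciForm_single, ← C.metric_single] at h1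
      simp only [LinearMap.sub_apply, LinearMap.neg_apply, LinearMap.smul_apply, smul_eq_mul,
        LeviCivitaModule.lieMetric_apply]
      linear_combination h1
    rw [← L.lieMetric_apply, h1]
    simp only [LinearMap.sub_apply, LinearMap.neg_apply, LinearMap.smul_apply, smul_eq_mul]
    change _ - _ * L.g _ _ = _
    rw [ricP, map_add, map_ofNat]; ring
  have hμ := trace_spatial _ (h.soliton hlieV)
  have hbb : L.act ξ b = - (2 * b) := by linear_combination hξb
  have : L.act ξ (2 * b) = 2 * L.act ξ b := by rw [two_mul, two_mul, map_add]
  rw [hbb, map_neg, this, hbb] at hμ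
  apply LeviCivitaModule.eq_zero_of_two_mul
  linear_combination -hμ

end CoordMetric

end

/-! ### Smooth functions on an open set of the coordinate space. -/

noncomputable section

namespace Spacetime

/-- The extension by zero of a function on `U`. -/
def zeroExt {U : Set R4} (f : U → ℝ) : R4 → ℝ := Function.extend Subtype.val f 0

theorem zeroExt_apply {U : Set R4} (f : U → ℝ) (u : U) : zeroExt f u = f u :=
  Subtype.val_injective.extend_apply _ _ _

theorem zeroExt_eqOn {U : Set R4} {f : U → ℝ} {F : R4 → ℝ} (h : ∀ u, f u = F u) :
    Set.EqOn (zeroExt f) F U := fun y hy => by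
  rw [show y = ((⟨y, hy⟩ : U) : R4) from rfl, zeroExt_apply, h]

/-- The algebra of smooth functions on `U`. -/
def smoothFun (U : Set R4) : Subalgebra ℝ (U → ℝ) where
  carrier := {f | ContDiffOn ℝ ∞ (zeroExt f) U}
  mul_mem' {f g} hf hg := (hf.mul hg).congr (zeroExt_eqOn fun u => by simp [zeroExt_apply])
  add_mem' {f g} hf hg := (hf.add hg).congr (zeroExt_eqOn fun u => by simp [zeroExt_apply])
  algebraMap_mem' c := (contDiffOn_const (c := c)).congr (zeroExt_eqOn fun u => rfl)

namespace smoothFun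

variable {U : Set R4}

/-- The restriction to `U` of a function that is smooth on `U`. -/
def mk (F : R4 → ℝ) (hF : ContDiffOn ℝ ∞ F U) : smoothFun U :=
  ⟨fun u => F u, hF.congr (zeroExt_eqOn fun _ => rfl)⟩

/-- Evaluation at a point of `U`. -/
def ev (u : U) : smoothFun U →ₐ[ℝ] ℝ := (Pi.evalAlgHom ℝ (fun _ : U => ℝ) u).comp (smoothFun U).val

theorem ev_mk (F : R4 → ℝ) (hF : ContDiffOn ℝ ∞ F U) (u : U) : ev u (mk F hF) = F u := rfl

theorem ext_ev {f g : smoothFun U} (h : ∀ u, ev u f = ev u g) : f = g :=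
  Subtype.ext (funext h)

theorem ev_algebraMap (u : U) (c : ℝ) : ev u (algebraMap ℝ (smoothFun U) c) = c :=
  (ev u).commutes c

end smoothFun

theorem pderiv_congr {U : Set R4} (hU : IsOpen U) {F F' : R4 → ℝ} (h : Set.EqOn F F' U) (i : Fin 4)
    {y : R4} (hy : y ∈ U) : pderiv i F y = pderiv i F' y := by
  rw [pderiv, pderiv, (h.eventuallyEq_of_mem (hU.mem_nhds hy)).fderiv_eq]

theorem contDiffOn_pderiv {U : Set R4} (hU : IsOpen U) {F : R4 → ℝ} (hF : ContDiffOn ℝ ∞ F U)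
    (i : Fin 4) : ContDiffOn ℝ ∞ (pderiv i F) U :=
  (hF.fderiv_of_isOpen hU (m := ∞) le_rfl).clm_apply contDiffOn_const

theorem pderiv_comm {U : Set R4} (hU : IsOpen U) {F : R4 → ℝ} (hF : ContDiffOn ℝ ∞ F U)
    (i j : Fin 4) {y : R4} (hy : y ∈ U) :
    pderiv i (pderiv j F) y = pderiv j (pderiv i F) y := by
  have hc := hF.contDiffAt (hU.mem_nhds hy)
  have hd : DifferentiableAt ℝ (fderiv ℝ F) y :=
    (hc.fderiv_right (m := ∞) le_rfl).differentiableAt (by simp)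
  have h (i j : Fin 4) : pderiv i (pderiv j F) y =
      fderiv ℝ (fderiv ℝ F) y (EuclideanSpace.single i 1) (EuclideanSpace.single j 1) := by
    have : pderiv j F = fun z => fderiv ℝ F z (EuclideanSpace.single j 1) := rfl
    rw [this, pderiv, fderiv_clm_apply hd (differentiableAt_const _)]
    simp
  rw [h, h]
  have h2 : (2 : WithTop ℕ∞) ≤ ∞ := WithTop.coe_le_coe.2 (le_top (a := (2 : ℕ∞)))
  exact (hc.isSymmSndFDerivAt (by simpa using h2)) _ _

/-- The `i`-th partial derivative as a derivation of the algebra of smooth functions. -/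
def smoothFun.partialDeriv {U : Set R4} (hU : IsOpen U) (i : Fin 4) :
    Derivation ℝ (smoothFun U) (smoothFun U) :=
  have dif (f : smoothFun U) (u : U) : DifferentiableAt ℝ (zeroExt f.1) u :=
    (f.2.contDiffAt (hU.mem_nhds u.2)).differentiableAt (by simp)
  Derivation.mk'
    { toFun := fun f => smoothFun.mk (pderiv i (zeroExt f.1)) (contDiffOn_pderiv hU f.2 i)
      map_add' := fun f g => Subtype.ext <| funext fun u => by
        have : Set.EqOn (zeroExt (f + g).1) (fun y => zeroExt f.1 y + zeroExt g.1 y) U :=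
          zeroExt_eqOn fun u => by simp [zeroExt_apply]
        change pderiv i _ _ = pderiv i _ _ + pderiv i _ _
        rw [pderiv_congr hU this i u.2, pderiv, fderiv_fun_add (dif f u) (dif g u)]
        rfl
      map_smul' := fun c f => Subtype.ext <| funext fun u => by
        have : Set.EqOn (zeroExt (c • f).1) (fun y => c • zeroExt f.1 y) U :=
          zeroExt_eqOn fun u => by simp [zeroExt_apply]
        change pderiv i _ _ = c • pderiv i _ _
        rw [pderiv_congr hU this i u.2, pderiv, fderiv_fun_const_smul (dif f u)]
        rfl }
    fun f g => Subtype.ext <| funext fun u => by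
      have : Set.EqOn (zeroExt (f * g).1) (fun y => zeroExt f.1 y * zeroExt g.1 y) U :=
        zeroExt_eqOn fun u => by simp [zeroExt_apply]
      change pderiv i _ _ = f.1 u * pderiv i _ _ + g.1 u * pderiv i _ _
      rw [pderiv_congr hU this i u.2, pderiv, fderiv_fun_mul (dif f u) (dif g u),
        zeroExt_apply, zeroExt_apply]
      rfl

open smoothFun

/-- F need only agree with f on U, so derivatives of expressions such as `christoffel` are evaluated
without a separate smoothness proof. -/
theorem ev_partialDeriv {U : Set R4} (hU : IsOpen U) (i : Fin 4) {f : smoothFun U} {F : R4 → ℝ}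
    (h : ∀ u, ev u f = F u) (u : U) : ev u (partialDeriv hU i f) = pderiv i F u :=
  pderiv_congr hU (zeroExt_eqOn h) i u.2

/-- Applied to the determinant, this makes the metric matrix invertible over the ring of smooth
functions. -/
theorem isUnit_of_ev_ne_zero {U : Set R4} {f : smoothFun U} (h : ∀ u, ev u f ≠ 0) : IsUnit f := by
  have hne (y) (hy : y ∈ U) : zeroExt f.1 y ≠ 0 := by
    rw [show y = ((⟨y, hy⟩ : U) : R4) from rfl, zeroExt_apply]; exact h _
  refine IsUnit.of_mul_eq_one (mk (fun y => (zeroExt f.1 y)⁻¹) (f.2.inv hne)) (ext_ev fun u => ?_)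
  rw [map_mul, ev_mk, zeroExt_apply, map_one]
  exact mul_inv_cancel₀ (h u)

section

variable {U : Set R4} (hU : IsOpen U) {G : R4 → Matrix (Fin 4) (Fin 4) ℝ}
  (hG : ∀ i j, ContDiffOn ℝ ∞ (fun y => G y i j) U) (hs : ∀ y ∈ U, ∀ i j, G y i j = G y j i)
  (hdet : ∀ y ∈ U, (G y).det ≠ 0)

include hdet in
theorem isUnit_det_smooth : IsUnit (Matrix.of fun i j => mk _ (hG i j)).det := by
  refine isUnit_of_ev_ne_zero fun u => ?_
  rw [AlgHom.map_det]
  exact hdet u u.2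

/-- A smooth metric on an open set of the coordinate space. -/
def coordMetric : CoordMetric (smoothFun U) where
  D := partialDeriv hU
  comm i j f := ext_ev fun u => by
    have h (j : Fin 4) : Set.EqOn (zeroExt (partialDeriv hU j f).1) (pderiv j (zeroExt f.1)) U :=
      zeroExt_eqOn fun _ => rfl
    change pderiv i (zeroExt (partialDeriv hU j f).1) u
      = pderiv j (zeroExt (partialDeriv hU i f).1) u
    rw [pderiv_congr hU (h j) i u.2, pderiv_congr hU (h i) j u.2]
    exact pderiv_comm hU f.2 i j u.2
  G := Matrix.of fun i j => mk _ (hG i j)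
  H := (Matrix.of fun i j => mk _ (hG i j))⁻¹
  symm i j := ext_ev fun u => hs u u.2 i j
  inv := Matrix.mul_nonsing_inv _ (isUnit_det_smooth hG hdet)

theorem ev_G (u : U) (i j : Fin 4) : ev u ((coordMetric hU hG hs hdet).G i j) = G u i j := rfl

theorem ev_D_G (u : U) (l i j : Fin 4) :
    ev u ((coordMetric hU hG hs hdet).D l ((coordMetric hU hG hs hdet).G i j)) =
      pderiv l (fun z => G z i j) u :=
  ev_partialDeriv hU l (F := fun z => G z i j) (ev_G hU hG hs hdet · i j) u

theorem ev_H (u : U) (i j : Fin 4) : ev u ((coordMetric hU hG hs hdet).H i j) = (G u)⁻¹ i j := by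
  have h := congrArg (fun N => (ev u).mapMatrix N) (coordMetric hU hG hs hdet).inv
  simp only [map_mul, map_one] at h
  have h2 : (ev u).mapMatrix (coordMetric hU hG hs hdet).G = G u := rfl
  rw [h2] at h
  rw [Matrix.inv_eq_right_inv h]
  rfl

theorem ev_chr (u : U) (k i j : Fin 4) : ev u ((coordMetric hU hG hs hdet).chr k i j) = christoffel G k i j u := by
  simp only [CoordMetric.chr, christoffel, map_mul, map_sum, map_add, map_sub, ev_algebraMap, ev_H,
    ev_D_G]

theorem ev_D_chr (u : U) (l k i j : Fin 4) :
    ev u ((coordMetric hU hG hs hdet).D l ((coordMetric hU hG hs hdet).chr k i j)) =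
      pderiv l (christoffel G k i j) u :=
  ev_partialDeriv hU l (F := christoffel G k i j) (ev_chr hU hG hs hdet · k i j) u

theorem ev_ric (u : U) (j k : Fin 4) : ev u ((coordMetric hU hG hs hdet).ric j k) = ricci G j k u := by
  simp only [CoordMetric.ric, ricci, CoordMetric.riem, riemann, map_mul, map_sum, map_add, map_sub,
    ev_chr, ev_D_chr]

include hU hG hs hdet in
/-- The soliton constant and the fluid data of a soliton in coordinates. -/
theorem soliton_coordinates {X V : R4 → Fin 4 → ℝ} {s p : R4 → ℝ} {lam κ c : ℝ}
    (hX : ∀ i, ContDiffOn ℝ ∞ (fun y => X y i) U) (hV : ∀ i, ContDiffOn ℝ ∞ (fun y => V y i) U)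
    (hss : ContDiffOn ℝ ∞ s U) (hp : ContDiffOn ℝ ∞ p U)
    (hunit : ∀ y ∈ U, ∑ i, ∑ j, G y i j * X y i * X y j = -1)
    (htorse : ∀ y ∈ U, ∀ i k, covDeriv G X i k y = (if i = k then 1 else 0) + lower G X i y * X y k)
    (hfluid : ∀ y ∈ U, ∀ i j, ricci G i j y + (lam - scalarCurv G y / 2) * G y i j =
      κ * (p y * G y i j + (s y + p y) * (lower G X i y * lower G X j y)))
    (hsol : ∀ y ∈ U, ∀ i j, lieDerivMetric G V i j y + 2 * ricci G i j y + 2 * c * G y i j = 0)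
    {y : R4} (hy : y ∈ U) :
    lam - κ * (s y + 3 * p y) / 2 = 3 ∧ c = -3 := by
  set C := coordMetric hU hG hs hdet with hC
  have eG := ev_G hU hG hs hdet
  have eH := ev_H hU hG hs hdet
  have eR := ev_ric hU hG hs hdet
  have eC := ev_chr hU hG hs hdet
  have eDG := ev_D_G hU hG hs hdet
  rw [← hC] at eG eH eR eC eDG
  let ξ : Fin 4 → smoothFun U := fun i => mk _ (hX i)
  let W : Fin 4 → smoothFun U := fun i => mk _ (hV i)
  have eξ (u : U) (i : Fin 4) : ev u (ξ i) = X u i := rfl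
  have eW (u : U) (i : Fin 4) : ev u (W i) = V u i := rfl
  have eDξ (u : U) (l i : Fin 4) : ev u (C.D l (ξ i)) = pderiv l (fun z => X z i) u :=
    ev_partialDeriv hU l (F := fun z => X z i) (eξ · i) u
  have eDW (u : U) (l i : Fin 4) : ev u (C.D l (W i)) = pderiv l (fun z => V z i) u :=
    ev_partialDeriv hU l (F := fun z => V z i) (eW · i) u
  let r : smoothFun U := ∑ j, ∑ k, C.H j k * C.ric j k
  let t := algebraMap ℝ (smoothFun U)
  -- The coefficients come from solving the field equation for S.
  let a : smoothFun U := t (1 / 2) * r - t lam + t κ * mk p hp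
  let b : smoothFun U := t κ * (mk s hss + mk p hp)
  have er (u : U) : ev u r = scalarCurv G u := by
    simp only [r, map_sum, map_mul, eH, eR, scalarCurv]
  have ea (u : U) : ev u a = scalarCurv G u / 2 - lam + κ * p u := by
    simp only [a, map_sub, map_add, map_mul, t, ev_algebraMap, er, ev_mk]; ring
  have eb (u : U) : ev u b = κ * (s u + p u) := by
    simp only [b, map_add, map_mul, t, ev_algebraMap, ev_mk]
  have key := C.soliton_const (ξ := ξ) (V := W) (a := a) (b := b) (c := c)
    (ext_ev fun u => by
      simpa only [map_sum, map_mul, map_neg, map_one, eG, eξ] using hunit u u.2)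
    (fun i k => ext_ev fun u => by
      have := htorse u u.2 i k
      simp only [map_sum, map_mul, map_add, eG, eξ, eC, eDξ, apply_ite (ev u),
        map_one, map_zero]
      exact this)
    (fun i j => ext_ev fun u => by
      have := hfluid u u.2 i j
      simp only [map_sum, map_mul, map_add, eG, eξ, eR, ea, eb]
      simp only [lower] at this
      linear_combination this)
    (fun i j => ext_ev fun u => by
      have := hsol u u.2 i j
      simp only [map_sum, map_mul, map_add, eG, eW, eR, ev_algebraMap, map_ofNat, map_zero,
        eDG, eDW]
      exact this)
  have k1 := congrArg (ev ⟨y, hy⟩) key.1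
  have k2 := congrArg (ev ⟨y, hy⟩) key.2
  rw [map_sub, ea, eb, map_ofNat] at k1
  rw [ev_algebraMap, map_zero] at k2
  have hinv : (G y)⁻¹ * G y = 1 := Matrix.nonsing_inv_mul _ (isUnit_iff_ne_zero.2 (hdet y hy))
  -- The trace r = 4a − b, with g(ξ,ξ) = −1; it eliminates r from a − b = 3.
  have hr : scalarCurv G y = 4 * (scalarCurv G y / 2 - lam + κ * p y) - κ * (s y + p y) := by
    have h1 (j k : Fin 4) : ricci G j k y = (scalarCurv G y / 2 - lam + κ * p y) * G y k j
        + κ * (s y + p y) * (lower G X j y * lower G X k y) := by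
      rw [hs y hy k j]
      linear_combination hfluid y hy j k
    have h2 (j : Fin 4) : ∑ k, (G y)⁻¹ j k * G y k j = 1 := by
      rw [← Matrix.mul_apply, hinv, Matrix.one_apply_eq]
    have h3 (j : Fin 4) : ∑ k, (G y)⁻¹ j k * lower G X k y = X y j := by
      have : (G y)⁻¹.mulVec ((G y).mulVec (X y)) = X y := by
        rw [Matrix.mulVec_mulVec, hinv, Matrix.one_mulVec]
      exact congrFun this j
    have h4 : ∑ j, lower G X j y * X y j = -1 := by
      rw [← hunit y hy]
      refine Finset.sum_congr rfl fun i _ => ?_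
      rw [lower, Finset.sum_mul]
      exact Finset.sum_congr rfl fun j _ => by ring
    have h5 : scalarCurv G y = ∑ j, ((scalarCurv G y / 2 - lam + κ * p y) *
        (∑ k, (G y)⁻¹ j k * G y k j) + κ * (s y + p y) *
          (lower G X j y * ∑ k, (G y)⁻¹ j k * lower G X k y)) := by
      conv_lhs => rw [scalarCurv]
      refine Finset.sum_congr rfl fun j _ => ?_
      simp only [Finset.mul_sum, ← Finset.sum_add_distrib]
      exact Finset.sum_congr rfl fun k _ => by rw [h1]; ring
    refine h5.trans ?_
    simp only [h2, h3, Finset.sum_add_distrib, ← Finset.mul_sum, h4]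
    simp
    ring
  exact ⟨by simp only at k1; linarith, by linarith⟩

end

/-! ### Chart components on the manifold. -/

variable {M : Type*} [TopologicalSpace M] [ChartedSpace R4 M] [IsManifold (𝓡 4) ∞ M]

/-- ∂_i is the image of a constant section under the tangent map of `e.symm`; on the open target,
`mfderivWithin` and `mfderiv` agree. -/
theorem contMDiffOn_coordVec {e : OpenPartialHomeomorph M R4} (he : e ∈ atlas R4 M) (i : Fin 4) :
    haveI : IsManifold (𝓡 4) 1 M := .of_le (n := ∞) (by simp)
    ContMDiffOn 𝓘(ℝ, R4) (𝓡 4).tangent ∞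
      (fun y => (⟨e.symm y, coordVec e y i⟩ : TangentBundle (𝓡 4) M)) e.target := by
  have : IsManifold (𝓡 4) 1 M := .of_le (n := ∞) (by simp)
  have h1 : ContMDiffOn 𝓘(ℝ, R4) (𝓡 4) ∞ e.symm e.target :=
    contMDiffOn_symm_of_mem_maximalAtlas (IsManifold.subset_maximalAtlas he)
  have h2 := h1.contMDiffOn_tangentMapWithin (m := ∞) le_rfl e.open_target.uniqueMDiffOn
  have h3 : ContMDiffOn 𝓘(ℝ, R4) (𝓡 4).tangent ∞
      (fun y => (⟨y, EuclideanSpace.single i (1 : ℝ)⟩ : TangentBundle 𝓘(ℝ, R4) R4)) e.target :=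
    fun y _ => contMDiffWithinAt_vectorSpace_iff_contDiffWithinAt.2 contDiffWithinAt_const
  refine (h2.comp h3 fun y hy => hy).congr fun y hy => ?_
  change _ = tangentMapWithin _ _ _ _ _
  rw [tangentMapWithin, mfderivWithin_of_isOpen e.open_target hy]
  rfl

theorem LorentzMetric.contDiffOn_inChart (g : LorentzMetric M) {e : OpenPartialHomeomorph M R4}
    (he : e ∈ atlas R4 M) (i j : Fin 4) : ContDiffOn ℝ ∞ (fun y => g.inChart e y i j) e.target := by
  have h1 : ContMDiffOn 𝓘(ℝ, R4) (𝓡 4) ∞ e.symm e.target :=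
    contMDiffOn_symm_of_mem_maximalAtlas (IsManifold.subset_maximalAtlas he)
  rw [← contMDiffOn_iff_contDiffOn]
  have h2 := g.contMDiff.comp_contMDiffOn h1
  intro y hy
  have h3 : ContMDiffWithinAt 𝓘(ℝ, R4) ((𝓡 4).prod 𝓘(ℝ, ℝ)) ∞
      (fun y => Bundle.TotalSpace.mk' ℝ (E := Bundle.Trivial M ℝ) (e.symm y)
        (g.val (e.symm y) (coordVec e y i) (coordVec e y j))) e.target y :=
    ContMDiffWithinAt.clm_bundle_apply₂ (F₁ := R4) (F₂ := R4) (h2 y hy)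
      (contMDiffOn_coordVec he i y hy) (contMDiffOn_coordVec he j y hy)
  exact (Bundle.contMDiffWithinAt_totalSpace.1 h3).2

theorem SmoothVectorField.contDiffOn_inChart (X : SmoothVectorField M)
    {e : OpenPartialHomeomorph M R4} (he : e ∈ atlas R4 M) (i : Fin 4) :
    ContDiffOn ℝ ∞ (fun y => X.inChart e y i) e.target := by
  have : IsManifold (𝓡 4) 1 M := .of_le (n := ∞) (by simp)
  have h1 : ContMDiffOn 𝓘(ℝ, R4) (𝓡 4) ∞ e.symm e.target :=
    contMDiffOn_symm_of_mem_maximalAtlas (IsManifold.subset_maximalAtlas he)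
  have h2 : ContMDiffOn (𝓡 4) 𝓘(ℝ, R4) ∞ e e.source :=
    contMDiffOn_of_mem_maximalAtlas (IsManifold.subset_maximalAtlas he)
  have h3 := h2.contMDiffOn_tangentMapWithin (m := ∞) le_rfl e.open_source.uniqueMDiffOn
  have h4 := h3.comp (X.contMDiff.comp_contMDiffOn h1) fun y hy => e.map_target hy
  have h5 := (contMDiff_snd_tangentBundle_modelSpace R4 𝓘(ℝ, R4) (n := ∞)).comp_contMDiffOn h4
  have h6 : ContDiffOn ℝ ∞ (fun y => (mfderiv (𝓡 4) 𝓘(ℝ, R4) e (e.symm y) (X.val (e.symm y)) : R4))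
      e.target := by
    refine (contMDiffOn_iff_contDiffOn.1 h5).congr fun y hy => ?_
    change _ = mfderivWithin (𝓡 4) 𝓘(ℝ, R4) e e.source (e.symm y) (X.val (e.symm y))
    rw [mfderivWithin_of_isOpen e.open_source (e.map_target hy)]
  exact (EuclideanSpace.proj (𝕜 := ℝ) i).contDiff.comp_contDiffOn h6

omit [IsManifold (𝓡 4) ∞ M] in
theorem sum_smul_coordVec (e : OpenPartialHomeomorph M R4) (y w : R4) :
    ∑ i, w i • coordVec e y i = mfderiv 𝓘(ℝ, R4) (𝓡 4) e.symm y w := by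
  have : w = ∑ i, w i • (EuclideanSpace.single i (1 : ℝ) : R4) := by
    ext j
    simp [Pi.single_apply]
  conv_rhs => rw [this]
  erw [map_sum]
  refine Finset.sum_congr rfl fun i _ => ?_
  erw [map_smul]
  rfl

theorem mfderiv_symm_mfderiv {e : OpenPartialHomeomorph M R4} (he : e ∈ atlas R4 M) {y : R4}
    (hy : y ∈ e.target) (v : TangentSpace (𝓡 4) (e.symm y)) :
    mfderiv 𝓘(ℝ, R4) (𝓡 4) e.symm y (mfderiv (𝓡 4) 𝓘(ℝ, R4) e (e.symm y) v) = v := by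
  have : IsManifold (𝓡 4) 1 M := .of_le (n := ∞) (by simp)
  have hm := mdifferentiable_of_mem_atlas (I := 𝓡 4) he
  apply hm.mfderiv_injective (e.map_target hy)
  exact congrArg (fun T => T (mfderiv (𝓡 4) 𝓘(ℝ, R4) e (e.symm y) v)) (hm.comp_symm_deriv hy)

theorem sum_mfderiv_smul_coordVec {e : OpenPartialHomeomorph M R4} (he : e ∈ atlas R4 M) {y : R4}
    (hy : y ∈ e.target) (v : TangentSpace (𝓡 4) (e.symm y)) :
    let w : R4 := mfderiv (𝓡 4) 𝓘(ℝ, R4) e (e.symm y) v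
    ∑ i, w i • coordVec e y i = v :=
  (sum_smul_coordVec e y _).trans (mfderiv_symm_mfderiv he hy v)

theorem sum_inChart_smul_coordVec (X : SmoothVectorField M) {e : OpenPartialHomeomorph M R4}
    (he : e ∈ atlas R4 M) {y : R4} (hy : y ∈ e.target) :
    ∑ i, X.inChart e y i • coordVec e y i = X.val (e.symm y) := by
  exact sum_mfderiv_smul_coordVec he hy _

theorem LorentzMetric.sum_inChart (g : LorentzMetric M) (e : OpenPartialHomeomorph M R4) (y : R4)
    (u w : Fin 4 → ℝ) : ∑ i, ∑ j, g.inChart e y i j * u i * w j =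
      g.val (e.symm y) (∑ i, u i • coordVec e y i) (∑ i, w i • coordVec e y i) := by
  simp only [map_sum, map_smul, sum_apply, smul_apply, smul_eq_mul, Finset.mul_sum]
  rw [Finset.sum_comm]
  refine Finset.sum_congr rfl fun i _ => Finset.sum_congr rfl fun j _ => ?_
  simp only [inChart, Matrix.of_apply]
  ring

theorem LorentzMetric.nondegenerate (g : LorentzMetric M) (p : M) (u : TangentSpace (𝓡 4) p)
    (h : ∀ v, g.val p v u = 0) : u = 0 := by
  obtain ⟨b, hb⟩ := g.signature p
  rw [← b.sum_repr u]
  refine Finset.sum_eq_zero fun i _ => ?_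
  have h1 := h (b i)
  rw [← b.sum_repr u, map_sum] at h1
  simp only [map_smul, hb, smul_eq_mul] at h1
  rw [Finset.sum_eq_single i (fun j _ hj => by simp [hj.symm]) (by simp)] at h1
  have h2 : b.repr u i = 0 := by
    rcases mul_eq_zero.1 h1 with h | h
    · exact h
    · split_ifs at h <;> simp_all
  rw [h2, zero_smul]

/-- A kernel vector of the Gram matrix gives a combination of the ∂_i orthogonal to their whole
span, the tangent space. Nondegeneracy makes it zero, and the differential of `e` then recovers zero
coefficients. -/
theorem LorentzMetric.det_inChart_ne_zero (g : LorentzMetric M) {e : OpenPartialHomeomorph M R4}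
    (he : e ∈ atlas R4 M) {y : R4} (hy : y ∈ e.target) : (g.inChart e y).det ≠ 0 := by
  have : IsManifold (𝓡 4) 1 M := .of_le (n := ∞) (by simp)
  intro hdet
  obtain ⟨v, hv, hGv⟩ := Matrix.exists_mulVec_eq_zero_iff.2 hdet
  have h1 : ∑ i, v i • coordVec e y i = 0 := by
    refine g.nondegenerate _ _ fun w => ?_
    obtain ⟨c, rfl⟩ : ∃ c : Fin 4 → ℝ, ∑ i, c i • coordVec e y i = w :=
      ⟨_, sum_mfderiv_smul_coordVec he hy w⟩
    rw [← g.sum_inChart]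
    refine Finset.sum_eq_zero fun i _ => ?_
    have := congrFun hGv i
    rw [Matrix.mulVec, dotProduct, Pi.zero_apply] at this
    simp only [mul_right_comm, ← Finset.sum_mul, this, zero_mul]
  have h2 := sum_smul_coordVec e y (WithLp.toLp 2 v)
  rw [show ∑ i, (WithLp.toLp 2 v : R4) i • coordVec e y i = 0 from h1] at h2
  have hm := mdifferentiable_of_mem_atlas (I := 𝓡 4) he
  have h3 := congrArg (fun T => T (WithLp.toLp 2 v : R4)) (hm.comp_symm_deriv hy)
  have h4 : (WithLp.toLp 2 v : R4) = 0 := by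
    rw [← show _ = (WithLp.toLp 2 v : R4) from h3]
    change mfderiv (𝓡 4) 𝓘(ℝ, R4) e (e.symm y) (mfderiv 𝓘(ℝ, R4) (𝓡 4) e.symm y _) = 0
    rw [← h2, map_zero]
  exact hv (by simpa using h4)

end Spacetime

end

/-! ### The theorem on the manifold. -/

theorem mainTheorem1 {M : Type*} [TopologicalSpace M] [ChartedSpace Spacetime.R4 M]
    [IsManifold (𝓡 4) ∞ M] [ConnectedSpace M]
    (g : Spacetime.LorentzMetric M) (ξ : Spacetime.SmoothVectorField M)
    (σ ρ : M → ℝ) (hσ : ContMDiff (𝓡 4) 𝓘(ℝ) ∞ σ) (hρ : ContMDiff (𝓡 4) 𝓘(ℝ) ∞ ρ)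
    (lam κ : ℝ)
    (hunit : Spacetime.IsUnitTimelike g ξ)
    (hfluid : Spacetime.PerfectFluidEquation g ξ σ ρ lam κ)
    (htorse : Spacetime.IsTorseForming g ξ)
    (V : Spacetime.SmoothVectorField M) (Λ : ℝ)
    (hsoliton : Spacetime.IsRicciSoliton g V Λ) :
    (∀ p : M, (2 * lam - κ * (σ p + 3 * ρ p)) * (lam - κ * (σ p + 3 * ρ p) / 2 + Λ) = 0) ∧
    (((∀ p : M, lam = κ * (σ p + 3 * ρ p) / 2) ∧
        Spacetime.RicciHasForm g ξ (fun p => κ * (σ p + ρ p)) (fun p => κ * (σ p + ρ p)) ∧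
        ¬ Spacetime.SolitonSteady Λ) ∨
      ((∀ p : M, Λ = κ * (σ p + 3 * ρ p) / 2 - lam) ∧
        ((Spacetime.SolitonExpanding Λ ∧ ∀ p : M, lam < κ * (σ p + 3 * ρ p) / 2) ∨
          (Spacetime.SolitonShrinking Λ ∧ ∀ p : M, κ * (σ p + 3 * ρ p) / 2 < lam)))) := by
  have key (p : M) : lam - κ * (σ p + 3 * ρ p) / 2 = 3 ∧ Λ = -3 := by
    set e := chartAt Spacetime.R4 p with hedef
    have he : e ∈ atlas Spacetime.R4 M := chart_mem_atlas _ p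
    have hp : p ∈ e.source := mem_chart_source _ p
    have hsymm : ContMDiffOn 𝓘(ℝ, Spacetime.R4) (𝓡 4) ∞ e.symm e.target :=
      contMDiffOn_symm_of_mem_maximalAtlas (IsManifold.subset_maximalAtlas he)
    have h := Spacetime.soliton_coordinates e.open_target (g.contDiffOn_inChart he)
      (fun y _ i j => g.symm _ _ _) (fun y hy => g.det_inChart_ne_zero he hy)
      (ξ.contDiffOn_inChart he) (V.contDiffOn_inChart he)
      (contMDiffOn_iff_contDiffOn.1 (hσ.comp_contMDiffOn hsymm))
      (contMDiffOn_iff_contDiffOn.1 (hρ.comp_contMDiffOn hsymm))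
      (fun y hy => by
        rw [g.sum_inChart, Spacetime.sum_inChart_smul_coordVec ξ he hy]
        exact hunit _)
      (htorse e he) (hfluid e he) (hsoliton e he) (e.map_source hp)
    simpa only [Function.comp_apply, e.left_inv hp] using h
  obtain ⟨p₀⟩ := (inferInstance : Nonempty M)
  have hΛ := (key p₀).2
  -- As Λ = −3, the second factor of the product vanishes, and the shrinking case of (2) holds.
  refine ⟨fun p => ?_, .inr ⟨fun p => ?_, .inr ⟨?_, fun p => ?_⟩⟩⟩
  · rw [(key p).1, hΛ]; ring
  · linarith [(key p).1]
  · rw [Spacetime.SolitonShrinking, hΛ]; norm_num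
  · linarith [(key p).1]
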